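/- Let $0<\alpha\le\frac12$, $0<s_{\min}<s_{\max}\le 1$, $0<p_{\max}<1$ and $\epsilon>0$. Let $X_1,\dots,X_n$ be independent items, where $X_i\sim\operatorname{Ber}(p_i,s_i)$, i.e. $X_i=s_i$ with probability $p_i$ and $X_i=0$ with probability $1-p_i$, with $0<p_i\le 1$ and $0<s_i\le s_{\max}$. A packing (a partition of the items into bins) is *viable* if $\mathbb P(\sum_{i\in\mathcal B}X_i>1)\le\alpha$ for each of its bins $\mathcal B$; $OPT$ is the smallest number of bins of a viable packing. For an integer $x\ge1$ let $Q(x,\lambda)=\Gamma(x,\lambda)/\Gamma(x)=\mathbb P(\operatorname{Poi}(\lambda)\le x-1)$, let $Q^{-1}(x,\cdot)$ be its inverse in the second argument, and put $$k_{\min}=\lfloor 1/s_{\max}\rfloor,\quad k_{\max}=\lceil 1/s_{\min}\rceil-1,\quad \lambda_k=Q^{-1}(k+1,1-\alpha),\quad \mu_0=\frac{2\alpha+s_{\min}-\sqrt{s_{\min}^2+4\alpha s_{\min}}}{2\alpha}.$$ The items are divided into groups: item $i$ is *confident* if $p_i>p_{\max}$; *minor* if $p_i\le p_{\max}$ and $s_i\le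 s_{\min}$; otherwise it is *standard*, of subgroup $k=\lfloor 1/s_i\rfloor$. The deterministic size $w_i$ of item $i$ is $s_i$ if it is confident, $p_is_i/\mu_0$ if it is minor, and $\log(1/(1-p_i))/\lambda_k$ if it is standard of subgroup $k$. RPAP packs every group (every subgroup, for standard items) online into its own bins by an Any-Fit algorithm with item sizes $w_i$ and bin size $1$; its asymptotic approximation constant is $$C=\frac{1+\alpha}{(1-\alpha)\mu_{\min}},\qquad \mu_{\min}=\tfrac12\min\bigl(p_{\max},\,\mu_0,\,(1-p_{\max})\lambda_{\min}\bigr),\qquad \lambda_{\min}=\frac{Q^{-1}\bigl(\lfloor 1/s_{\max}\rfloor+1,\,1-\alpha\bigr)}{\lfloor 1/s_{\max}\rfloor+1}.$$ The algorithm RPAPC handles the items online in the order $X_1,\dots,X_n$ and uses the same groups. It puts item $i$ in the first open bin $\mathcal B$ of the group of $i$ such that, with $\mathcal B'=\mathcal B\cup\{i\}$, at least one of the following holds: (RPAP test) $\sum_{j\in\mathcal B'}w_j\le1$; or (First Fit Rounded test) $\mathbb P(\sum_{j\in\mathcal B'}\hat X_j>1)\le\alpha$, where the $\hat X_j\sim\operatorname{Ber}(p_j,\epsilon\lceil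 s_j/\epsilon\rceil)$ are independent. If there is no such bin, it opens a new bin for $i$ in that group. Then RPAPC is an approximation algorithm whose approximation constant is at most that of RPAP: for every such input its output is a viable packing of all the items, and its number of bins $M$ satisfies $$M\le C\cdot OPT+k_{\max}-k_{\min}+3 .$$ -/

import Mathlib

open MeasureTheory ProbabilityTheory
open scoped NNReal

noncomputable section

namespace StochasticBinPacking

/-! ### Scaled Bernoulli items, viable packings, the optimum -/

/-- An item with scaled Bernoulli distribution `Ber(prob, size)`:
it equals `size` with probability `prob` and `0` with probability `1 - prob`. -/
structure Item where
  size : ℝ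
  prob : unitInterval

/-- The joint law of independent items `X 0, …, X (n - 1)`: the product of the scaled Bernoulli
laws `Ber(prob, size)`. -/
def jointLaw {n : ℕ} (X : Fin n → Item) : Measure (Fin n → ℝ) :=
  Measure.pi fun i => bernoulliMeasure (X i).size 0 (X i).prob

/-- The probability that the independent items with indices in `B` overflow a bin of
capacity `1`, that is `ℙ(∑ i ∈ B, X i > 1)`. -/
def overflowProb {n : ℕ} (X : Fin n → Item) (B : Finset (Fin n)) : ℝ :=
  (jointLaw X).real {x | 1 < ∑ i ∈ B, x i}

/-- A list of bins (each given by the set of the items it contains) is a viable packing: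
each item lies in exactly one bin, and each bin overflows with probability at most `α`. -/
structure IsViablePacking {n : ℕ} (α : ℝ) (X : Fin n → Item)
    (bins : List (Finset (Fin n))) : Prop where
  disjoint : bins.Pairwise Disjoint
  covers : ∀ i, ∃ B ∈ bins, i ∈ B
  viable : ∀ B ∈ bins, overflowProb X B ≤ α

/-- `OPT`, the smallest number of bins of a viable packing. -/
def opt {n : ℕ} (α : ℝ) (X : Fin n → Item) : ℕ :=
  sInf {m | ∃ bins : List (Finset (Fin n)), IsViablePacking α X bins ∧ bins.length = m}

/-! ### The Poisson distribution function and its inverse -/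

/-- The regularized incomplete gamma function `Q(x, l) = Γ(x, l) / Γ(x)` at a positive integer `x`,
written as a Poisson distribution function: `Q(k + 1, l) = ℙ(Poi(l) ≤ k)`. -/
def poissonQ (x : ℕ) (l : ℝ≥0) : ℝ :=
  (poissonMeasure l).real (Set.Iio x)

/-- `Q⁻¹(x, γ)`, the inverse of `Q` in the second argument. As `Q(x, ·)` is continuous and strictly
decreasing from `1` to `0` for `x ≥ 1`, it is the largest `l` with `Q(x, l) ≥ γ`. -/
def poissonQInv (x : ℕ) (γ : ℝ) : ℝ :=
  ((sSup {l : ℝ≥0 | γ ≤ poissonQ x l} : ℝ≥0) : ℝ)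

/-! ### Parameters and groups of items -/

/-- The parameters shared by RPAP and RPAPC: the maximal overflow probability `α`, the largest size
of an item `sMax`, the largest size `sMin` of a minor item, and the probability `pMax` above which
an item is confident. -/
structure Params where
  α : ℝ
  sMax : ℝ
  sMin : ℝ
  pMax : ℝ

namespace Params

def kMin (P : Params) : ℕ := ⌊1 / P.sMax⌋₊

def kMax (P : Params) : ℕ := ⌈1 / P.sMin⌉₊ - 1

/-- The scaling factor `λₖ` of the `k`-th subgroup of standard items. -/
def lam (P : Params) (k : ℕ) : ℝ := poissonQInv (k + 1) (1 - P.α)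

/-- The scaling factor of minor items. -/
def mu0 (P : Params) : ℝ :=
  (2 * P.α + P.sMin - Real.sqrt (P.sMin ^ 2 + 4 * P.α * P.sMin)) / (2 * P.α)

/-- `λ_min = Q⁻¹(⌊1 / s_max⌋ + 1, 1 - α) / (⌊1 / s_max⌋ + 1)`. -/
def lamMin (P : Params) : ℝ :=
  1 / ((⌊1 / P.sMax⌋₊ : ℝ) + 1) * poissonQInv (⌊1 / P.sMax⌋₊ + 1) (1 - P.α)

/-- `μ_min = min (p_max, μ₀, (1 - p_max) λ_min) / 2`. -/
def muMin (P : Params) : ℝ :=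
  1 / 2 * min P.pMax (min P.mu0 ((1 - P.pMax) * P.lamMin))

/-- The (asymptotic) approximation constant of RPAP. -/
def approxConstant (P : Params) : ℝ :=
  (1 + P.α) / ((1 - P.α) * P.muMin)

end Params

/-- The names of the separately packed groups of items. -/
inductive Group where
  | confident
  | minor
  | standard (k : ℕ)
  deriving DecidableEq

/-- The group of an item. -/
def groupOf (P : Params) (x : Item) : Group :=
  if P.pMax < x.prob then .confident
  else if x.size ≤ P.sMin then .minor
  else .standard ⌊1 / x.size⌋₊

/-- The deterministic size by which an item is packed within a group by RPAP. -/
def weight (P : Params) : Group → Item → ℝ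
  | .confident, x => x.size
  | .minor, x => x.prob * x.size / P.mu0
  | .standard k, x => Real.log (1 / (1 - x.prob)) / P.lam k

/-! ### The RPAPC algorithm -/

/-- The item with its size rounded up to an integer multiple of `ε`. -/
def Item.roundUp (ε : ℝ) (x : Item) : Item where
  size := ⌈x.size / ε⌉₊ * ε
  prob := x.prob

/-- The test of RPAP: the deterministic sizes of the content `B` of a bin of group `g` sum up to
at most `1`. -/
def rpapFits {n : ℕ} (P : Params) (X : Fin n → Item) (g : Group) (B : Finset (Fin n)) : Prop :=
  ∑ i ∈ B, weight P g (X i) ≤ 1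

/-- The test of First Fit Rounded: the items of `B`, with their sizes rounded up to integer
multiples of `ε`, overflow a bin with probability at most `α`. -/
def ffrFits {n : ℕ} (P : Params) (ε : ℝ) (X : Fin n → Item) (B : Finset (Fin n)) : Prop :=
  overflowProb (fun i => (X i).roundUp ε) B ≤ P.α

open Classical in
/-- One First Fit step: put item `i` in the first bin `B` whose content `insert i B` would pass
the test `fits`; if there is none, open a new bin for `i` behind the other bins. -/
def firstFit {n : ℕ} (fits : Finset (Fin n) → Prop) (i : Fin n) :
    List (Finset (Fin n)) → List (Finset (Fin n))
  | [] => [{i}]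
  | B :: bins => if fits (insert i B) then insert i B :: bins else B :: firstFit fits i bins

/-- One step of RPAPC, which packs item `i`. The state holds the list of open bins of each group.
The item is put in the first bin of its group where the test of RPAP or the test of First Fit
Rounded succeeds; if there is none, a new bin is opened for it in that group. -/
def rpapcStep {n : ℕ} (P : Params) (ε : ℝ) (X : Fin n → Item)
    (state : Group → List (Finset (Fin n))) (i : Fin n) : Group → List (Finset (Fin n)) :=
  let g := groupOf P (X i)
  Function.update state g
    (firstFit (fun B => rpapFits P X g B ∨ ffrFits P ε X B) i (state g))

/-- The lists of bins of the groups after RPAPC has packed all items online, in the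
order `X 0, X 1, …, X (n - 1)`. -/
def rpapcState {n : ℕ} (P : Params) (ε : ℝ) (X : Fin n → Item) : Group → List (Finset (Fin n)) :=
  (List.finRange n).foldl (rpapcStep P ε X) fun _ => []

/-- The packing returned by RPAPC: the bins of confident items, of minor items, and of standard
items of the subgroups `kMin, …, kMax`. -/
def rpapc {n : ℕ} (P : Params) (ε : ℝ) (X : Fin n → Item) : List (Finset (Fin n)) :=
  rpapcState P ε X .confident ++ rpapcState P ε X .minor ++
    (List.range' P.kMin (P.kMax + 1 - P.kMin)).flatMap fun k => rpapcState P ε X (.standard k)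

end StochasticBinPacking

end

namespace StochasticBinPacking

/-! ### Tail probabilities of the content of a bin -/

/-! Viability and the bin count are separate, and no run of RPAP is compared with.

Every bin of RPAPC is a singleton of size at most 1 or has passed a test. Rounding sizes up only
raises tail probabilities, so the First Fit Rounded test is safe. The RPAP test is safe by group
(`overflowProb_le_of_rpapFits`): confident sizes sum to at most 1; for minor items `mu0` is the mean
at which Chebyshev's bound equals `α`; standard items of subgroup `k` have size at most `1 / k`, so
an overflow needs `k + 1` nonzero items, and their number is dominated by a Poisson variable of rate
`∑ log (1 / (1 - p))` (`tailProb_le_poissonTail`).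

For the count, First Fit passes over a bin only if the RPAP test fails there. So any two bins of a
group weigh more than 1 together, and a group of total weight `W` uses at most `2 * W + 1` bins. An
item's weight is at most its mean size over `2 * muMin` (`weight_le`), where one constant serves all
subgroups because `lam k / (k + 1)` is nondecreasing in `k` (`monotone_poissonQInv_div`). A viable
bin has mean content at most `(1 + α) / (1 - α)` (`sum_mean_le`); summing over an optimal packing
gives the constant. -/

/-- The probability that the items with indices in `B` have total size larger than `t`. -/
noncomputable def tailProb {n : ℕ} (X : Fin n → Item) (B : Finset (Fin n)) (t : ℝ) : ℝ :=
  (jointLaw X).real {x | t < ∑ i ∈ B, x i}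

section Tail

variable {n : ℕ} (X : Fin n → Item)

instance : IsProbabilityMeasure (jointLaw X) := by
  unfold jointLaw; infer_instance

lemma overflowProb_eq_tailProb (B : Finset (Fin n)) : overflowProb X B = tailProb X B 1 := rfl

lemma tailProb_nonneg (B : Finset (Fin n)) (t : ℝ) : 0 ≤ tailProb X B t := measureReal_nonneg

lemma tailProb_le_one (B : Finset (Fin n)) (t : ℝ) : tailProb X B t ≤ 1 := measureReal_le_one

lemma tailProb_empty (t : ℝ) : tailProb X ∅ t = if t < 0 then 1 else 0 := by
  unfold tailProb
  split_ifs with h <;> simp [h]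

lemma tailProb_antitone (B : Finset (Fin n)) : Antitone (tailProb X B) := by
  intro t u h
  refine measureReal_mono fun x hx => ?_
  exact lt_of_le_of_lt h hx

/-- Conditioning on item `i`, which is independent of the sum over `B`. The tail bounds below are
inductions on this recursion and need no further measure theory. -/
lemma tailProb_insert {B : Finset (Fin n)} {i : Fin n} (hi : i ∉ B) (t : ℝ) :
    tailProb X (insert i B) t =
      (X i).prob * tailProb X B (t - (X i).size) + (1 - (X i).prob) * tailProb X B t := by
  have hmeas : ∀ j, Measurable fun x : Fin n → ℝ => x j := fun j => measurable_pi_apply j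
  have hind : iIndepFun (fun j (x : Fin n → ℝ) => x j) (jointLaw X) :=
    iIndepFun_pi (X := fun _ => id) fun _ => aemeasurable_id
  have h2 := (hind.indepFun_finsetSum_of_notMem hmeas hi).symm
  have hS : Measurable (∑ j ∈ B, fun x : Fin n → ℝ => x j) :=
    by simpa [Finset.sum_fn] using Finset.measurable_sum B fun j _ => hmeas j
  have hmap := (indepFun_iff_map_prod_eq_prod_map_map (hmeas i).aemeasurable hS.aemeasurable).1 h2
  have hlaw : (jointLaw X).map (fun x : Fin n → ℝ => x i)
      = bernoulliMeasure (X i).size 0 (X i).prob :=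
    (measurePreserving_eval (fun i => bernoulliMeasure (X i).size 0 (X i).prob) i).map_eq
  have hset : MeasurableSet {q : ℝ × ℝ | t < q.1 + q.2} :=
    measurableSet_lt measurable_const (measurable_fst.add measurable_snd)
  have hsec : ∀ a : ℝ, ((jointLaw X).map (∑ j ∈ B, fun x : Fin n → ℝ => x j))
      (Prod.mk a ⁻¹' {q : ℝ × ℝ | t < q.1 + q.2}) = ENNReal.ofReal (tailProb X B (t - a)) := by
    intro a
    rw [Measure.map_apply hS (measurable_prodMk_left hset), tailProb, ofReal_measureReal]
    congr 1
    ext x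
    simp [Finset.sum_apply, sub_lt_iff_lt_add']
  have key : (jointLaw X) {x | t < ∑ j ∈ insert i B, x j} =
      ∫⁻ a, ENNReal.ofReal (tailProb X B (t - a)) ∂(bernoulliMeasure (X i).size 0 (X i).prob) := by
    rw [← hlaw]
    simp_rw [← hsec]
    rw [← Measure.prod_apply hset, ← hmap, Measure.map_apply ((hmeas i).prodMk hS) hset]
    congr 1
    ext x
    simp [Finset.sum_insert hi, Finset.sum_apply]
  have hm : Measurable fun a => ENNReal.ofReal (tailProb X B (t - a)) := by
    refine ENNReal.measurable_ofReal.comp ?_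
    exact (tailProb_antitone X B).measurable.comp (measurable_const.sub measurable_id)
  rw [tailProb, measureReal_def, key, bernoulliMeasure_def, lintegral_add_measure,
    lintegral_smul_measure, lintegral_smul_measure, lintegral_dirac' _ hm, lintegral_dirac' _ hm,
    ENNReal.smul_def, ENNReal.smul_def, smul_eq_mul, smul_eq_mul,
    ENNReal.toReal_add (by finiteness) (by finiteness)]
  simp [ ENNReal.toReal_mul, ENNReal.toReal_ofReal (tailProb_nonneg _ _ _)]

lemma tailProb_eq_one_of_neg (hs : ∀ i, 0 ≤ (X i).size) (B : Finset (Fin n)) :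
    ∀ t : ℝ, t < 0 → tailProb X B t = 1 := by
  induction B using Finset.induction_on with
  | empty => intro t ht; simp [tailProb_empty, ht]
  | insert i B hi ih =>
    intro t ht
    rw [tailProb_insert X hi, ih t ht, ih _ (by linarith [hs i])]
    ring

lemma tailProb_eq_zero_of_sum_size_le (hs : ∀ i, 0 ≤ (X i).size) (B : Finset (Fin n)) :
    ∀ t : ℝ, ∑ i ∈ B, (X i).size ≤ t → tailProb X B t = 0 := by
  induction B using Finset.induction_on with
  | empty => intro t ht; simpa [tailProb_empty] using ht
  | insert i B hi ih =>
    intro t ht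
    rw [Finset.sum_insert hi] at ht
    rw [tailProb_insert X hi, ih t (by linarith [hs i]), ih _ (by linarith [hs i])]
    ring

/-- Enlarging the sizes of the items increases the tail probabilities. -/
lemma tailProb_mono_size {X Y : Fin n → Item} (hprob : ∀ i, (X i).prob = (Y i).prob)
    (hsize : ∀ i, (X i).size ≤ (Y i).size) (B : Finset (Fin n)) :
    ∀ t, tailProb X B t ≤ tailProb Y B t := by
  induction B using Finset.induction_on with
  | empty => intro t; simp [tailProb_empty]
  | insert i B hi ih =>
    intro t
    rw [tailProb_insert X hi, tailProb_insert Y hi, ← hprob i]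
    have h1 := ih (t - (X i).size)
    have h2 : tailProb Y B (t - (X i).size) ≤ tailProb Y B (t - (Y i).size) :=
      tailProb_antitone Y B (by linarith [hsize i])
    have h0 := (X i).prob.2.1
    have h0' := (X i).prob.2.2
    have := ih t
    gcongr
    exact h1.trans h2

/-- A shifted Chebyshev inequality for the content of a bin. -/
lemma tailProb_mul_sq_le (B : Finset (Fin n)) :
    ∀ t a : ℝ, a ≤ t → tailProb X B t * (t - a) ^ 2 ≤
      ∑ i ∈ B, ((X i).prob * (1 - (X i).prob) * (X i).size ^ 2) +
        (∑ i ∈ B, (X i).prob * (X i).size - a) ^ 2 := by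
  induction B using Finset.induction_on with
  | empty =>
    intro t a hta
    rw [tailProb_empty]
    split_ifs with h
    · simp only [Finset.sum_empty]
      nlinarith
    · simp only [Finset.sum_empty]
      nlinarith [sq_nonneg a]
  | insert i B hi ih =>
    intro t a hta
    rw [tailProb_insert X hi, Finset.sum_insert hi, Finset.sum_insert hi]
    -- The right-hand side is `E (S - a) ^ 2`. When item `i` is nonzero, `t` and `a` shift together
    -- and `t - a` is unchanged; this is why `a` is arbitrary rather than the mean.
    have h1 := ih (t - (X i).size) (a - (X i).size) (by linarith)
    have h2 := ih t a hta
    have h0 := (X i).prob.2.1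
    have h0' : (0 : ℝ) ≤ 1 - (X i).prob := by linarith [(X i).prob.2.2]
    have h3 := mul_le_mul_of_nonneg_left h1 h0
    have h4 := mul_le_mul_of_nonneg_left h2 h0'
    rw [show t - (X i).size - (a - (X i).size) = t - a by ring] at h3
    linarith

/-- A bound on the mean content of a bin by its overflow probability. -/
lemma sum_mean_le (hs : ∀ i, 0 ≤ (X i).size) (hs' : ∀ i, (X i).size ≤ 1) {M : ℝ}
    (B : Finset (Fin n)) (hM : ∑ i ∈ B, (X i).prob * (X i).size ≤ M) :
    ∀ t : ℝ, 0 ≤ t →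
      ∑ i ∈ B, (X i).prob * (X i).size ≤ t + (1 + M) * tailProb X B t := by
  induction B using Finset.induction_on with
  | empty =>
    intro t ht
    simpa [tailProb_empty, not_lt.2 ht] using ht
  | insert i B hi ih =>
    intro t ht
    have h0 := (X i).prob.2.1
    have h0' : (0 : ℝ) ≤ 1 - (X i).prob := by linarith [(X i).prob.2.2]
    rw [Finset.sum_insert hi] at hM
    have hMB : ∑ i ∈ B, (X i).prob * (X i).size ≤ M := by
      linarith [mul_nonneg h0 (hs i)]
    rw [tailProb_insert X hi, Finset.sum_insert hi]
    have h2 := ih hMB t ht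
    -- If item `i` alone exceeds `t`, the tail is 1, and size at most 1 plus remaining mean at most
    -- `M` pays for it. Keeping `M` apart from the sum lets it stay fixed in the induction.
    have h1 : (X i).size + ∑ i ∈ B, (X i).prob * (X i).size
        ≤ t + (1 + M) * tailProb X B (t - (X i).size) := by
      rcases le_or_gt 0 (t - (X i).size) with h | h
      · linarith [ih hMB _ h]
      · rw [tailProb_eq_one_of_neg X hs B _ h]
        linarith [hs' i]
    have h3 := mul_le_mul_of_nonneg_left h1 h0
    have h4 := mul_le_mul_of_nonneg_left h2 h0'
    linarith

end Tail

/-! ### Poisson tails -/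

/-- The tail `ℙ(Poi(l) ≥ j)` of the Poisson distribution. -/
noncomputable def poissonTail (l : ℝ) (j : ℕ) : ℝ :=
  1 - Real.exp (-l) * ∑ i ∈ Finset.range j, l ^ i / (i.factorial : ℝ)

@[simp]
lemma poissonTail_zero_right (l : ℝ) : poissonTail l 0 = 1 := by simp [poissonTail]

lemma poissonTail_succ (l : ℝ) (j : ℕ) :
    poissonTail l (j + 1) = poissonTail l j - Real.exp (-l) * (l ^ j / (j.factorial : ℝ)) := by
  simp only [poissonTail, Finset.sum_range_succ]
  ring

lemma poissonTail_zero_succ (j : ℕ) : poissonTail 0 (j + 1) = 0 := by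
  simp [poissonTail, Finset.sum_range_succ']

lemma poissonQ_eq (x : ℕ) (l : ℝ≥0) : poissonQ x l = 1 - poissonTail l x := by
  have h : (Set.Iio x) = ((Finset.range x : Finset ℕ) : Set ℕ) := by ext; simp
  rw [poissonQ, h, ← sum_measureReal_singleton, poissonTail, Finset.mul_sum]
  simp_rw [poissonMeasure_real_singleton]
  simp [mul_div_assoc]

/-- The derivatives of the terms telescope to one Poisson weight, the Gamma density: at least `j +
1` Poisson points by time `l` means that the `(j + 1)`-st arrival is at most `l`. -/
lemma hasDerivAt_poissonTail (j : ℕ) (l : ℝ) :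
    HasDerivAt (fun l => poissonTail l (j + 1)) (Real.exp (-l) * (l ^ j / (j.factorial : ℝ))) l := by
  have hexp : HasDerivAt (fun l : ℝ => Real.exp (-l)) (-Real.exp (-l)) l := by
    simpa using (hasDerivAt_neg l).exp
  induction j with
  | zero =>
    simp only [poissonTail_succ, poissonTail_zero_right]
    simpa using hexp.const_sub 1
  | succ j ih =>
    have hpow := ((hasDerivAt_pow (j + 1) l).div_const ((j + 1).factorial : ℝ))
    have h := ih.sub (hexp.mul hpow)
    simp_rw [fun l => poissonTail_succ l (j + 1)]
    refine h.congr_deriv ?_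
    rw [Nat.factorial_succ]
    push_cast
    have : (j.factorial : ℝ) ≠ 0 := by positivity
    field_simp
    simp

lemma poissonTail_mono {l m : ℝ} (hl : 0 ≤ l) (hlm : l ≤ m) (j : ℕ) :
    poissonTail l j ≤ poissonTail m j := by
  cases j with
  | zero => simp
  | succ j =>
    refine monotoneOn_of_deriv_nonneg (convex_Ici 0)
      (fun x _ => (hasDerivAt_poissonTail j x).continuousAt.continuousWithinAt)
      (fun x _ => (hasDerivAt_poissonTail j x).differentiableAt.differentiableWithinAt) ?_
      (Set.mem_Ici.2 hl) (Set.mem_Ici.2 (hl.trans hlm)) hlm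
    intro x hx
    rw [interior_Ici, Set.mem_Ioi] at hx
    rw [(hasDerivAt_poissonTail j x).deriv]
    positivity

lemma poissonTail_lt {l m : ℝ} (hl : 0 ≤ l) (hlm : l < m) (j : ℕ) :
    poissonTail l (j + 1) < poissonTail m (j + 1) := by
  refine strictMonoOn_of_deriv_pos (f := fun l => poissonTail l (j + 1)) (convex_Ici 0)
    (fun x _ => (hasDerivAt_poissonTail j x).continuousAt.continuousWithinAt) ?_
    (Set.mem_Ici.2 hl) (Set.mem_Ici.2 (hl.trans hlm.le)) hlm
  intro x hx
  rw [interior_Ici, Set.mem_Ioi] at hx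
  rw [(hasDerivAt_poissonTail j x).deriv]
  positivity

lemma poissonTail_nonneg {l : ℝ} (hl : 0 ≤ l) (j : ℕ) : 0 ≤ poissonTail l j := by
  cases j with
  | zero => simp
  | succ j => rw [← poissonTail_zero_succ j]; exact poissonTail_mono le_rfl hl _

/-- Adding a Bernoulli variable of parameter `1 - exp (-u)` to a Poisson variable gives a
stochastically smaller variable than increasing the rate by `u`. -/
lemma poissonTail_add_bernoulli_le {l u : ℝ} (hl : 0 ≤ l) (hu : 0 ≤ u) (j : ℕ) :
    (1 - Real.exp (-u)) * poissonTail l j + Real.exp (-u) * poissonTail l (j + 1) ≤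
      poissonTail (l + u) (j + 1) := by
  -- The claim is `h 0 ≤ h u` multiplied by `exp (-u)`. The factor `exp x` makes the derivative a
  -- difference of tails at the same index `j`.
  let h : ℝ → ℝ := fun x => Real.exp x * (poissonTail (l + x) (j + 1) - poissonTail l j)
  have hd : ∀ x, HasDerivAt h (Real.exp x * (poissonTail (l + x) j - poissonTail l j)) x := by
    intro x
    have h1 : HasDerivAt (fun x => poissonTail (l + x) (j + 1))
        (Real.exp (-(l + x)) * ((l + x) ^ j / (j.factorial : ℝ))) x := by
      simpa using (hasDerivAt_poissonTail j (l + x)).comp_const_add l x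
    refine ((Real.hasDerivAt_exp x).mul (h1.sub_const (poissonTail l j))).congr_deriv ?_
    rw [poissonTail_succ]
    ring
  have hmono : MonotoneOn h (Set.Ici 0) := by
    refine monotoneOn_of_deriv_nonneg (convex_Ici 0)
      (fun x _ => (hd x).continuousAt.continuousWithinAt)
      (fun x _ => (hd x).differentiableAt.differentiableWithinAt) ?_
    intro x hx
    rw [interior_Ici, Set.mem_Ioi] at hx
    rw [(hd x).deriv]
    have := poissonTail_mono hl (show l ≤ l + x by linarith) j
    exact mul_nonneg (Real.exp_pos x).le (by linarith)
  have h0 := hmono (Set.mem_Ici.2 le_rfl) (Set.mem_Ici.2 hu) hu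
  simp only [h, Real.exp_zero, add_zero, one_mul] at h0
  have h2 := mul_le_mul_of_nonneg_left h0 (Real.exp_pos (-u)).le
  rw [← mul_assoc, ← Real.exp_add, neg_add_cancel, Real.exp_zero, one_mul] at h2
  linarith

/-! ### Monotonicity of the normalized Poisson quantiles -/

/-- The function `exp (-u) * u ^ n` peaks at `u = n`: raise `x ≤ exp (x - 1)` at `x = u / n` to the
power `n`. -/
lemma exp_neg_mul_pow_le {n : ℕ} {u : ℝ} (hu : (n : ℝ) ≤ u) :
    Real.exp (-u) * u ^ n ≤ Real.exp (-n) * (n : ℝ) ^ n := by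
  rcases Nat.eq_zero_or_pos n with rfl | hn
  · simpa using hu
  have hn' : (0 : ℝ) < n := by exact_mod_cast hn
  have h1 : u / n ≤ Real.exp (u / n - 1) := by
    linarith [Real.add_one_le_exp (u / n - 1)]
  have h2 : (u / n) ^ n ≤ Real.exp (u / n - 1) ^ n :=
    pow_le_pow_left₀ (by have := hn'.le.trans hu; positivity) h1 n
  rw [← Real.exp_nat_mul, mul_sub, mul_div_cancel₀ _ hn'.ne', mul_one, div_pow,
    div_le_iff₀ (by positivity)] at h2
  calc Real.exp (-u) * u ^ n ≤ Real.exp (-u) * (Real.exp (u - n) * (n : ℝ) ^ n) := by gcongr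
    _ = Real.exp (-n) * (n : ℝ) ^ n := by
      rw [← mul_assoc, ← Real.exp_add]
      congr 2
      ring

/-- `ℙ(Poi(n) ≥ n)` is nonincreasing in `n`. -/
lemma poissonTail_self_succ_le (n : ℕ) :
    poissonTail ((n : ℝ) + 1) (n + 1) ≤ poissonTail n n := by
  have hd := fun x => hasDerivAt_poissonTail n x
  -- Raising the rate from `n` to `n + 1` adds the weight of `n` at some rate `c > n`. That is at
  -- most its weight at rate `n`, which is the gap between the tails at `n` and `n + 1`.
  obtain ⟨c, hc, hc'⟩ := exists_deriv_eq_slope (fun l => poissonTail l (n + 1))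
    (show (n : ℝ) < n + 1 by linarith)
    (fun x _ => (hd x).continuousAt.continuousWithinAt)
    (fun x _ => (hd x).differentiableAt.differentiableWithinAt)
  rw [(hd c).deriv] at hc'
  have h1 := poissonTail_succ n n
  have h2 := exp_neg_mul_pow_le hc.1.le
  have h3 : Real.exp (-c) * (c ^ n / (n.factorial : ℝ)) ≤
      Real.exp (-n) * ((n : ℝ) ^ n / (n.factorial : ℝ)) := by
    rw [← mul_div_assoc, ← mul_div_assoc]
    gcongr
  rw [hc'] at h3
  simp only [add_sub_cancel_left, div_one] at h3
  linarith

/-- The weights of `Poi(n)` at `n - 1 - j` and `n + j` compare. -/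
lemma pow_div_factorial_le {n j : ℕ} (hj : j < n) :
    (n : ℝ) ^ (n - 1 - j) / ((n - 1 - j).factorial : ℝ) ≤
      (n : ℝ) ^ (n + j) / ((n + j).factorial : ℝ) := by
  induction j with
  | zero =>
    obtain ⟨m, rfl⟩ : ∃ m, n = m + 1 := ⟨n - 1, by omega⟩
    simp only [Nat.add_sub_cancel, Nat.sub_zero, Nat.add_zero]
    rw [Nat.factorial_succ, pow_succ]
    push_cast
    have : (m.factorial : ℝ) ≠ 0 := by positivity
    have : ((m : ℝ) + 1) ≠ 0 := by positivity
    apply le_of_eq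
    field_simp
  | succ j ih =>
    have ih := ih (by omega)
    obtain ⟨m, rfl⟩ : ∃ m, n = m + 1 + (j + 1) := ⟨n - 1 - (j + 1), by omega⟩
    rw [show m + 1 + (j + 1) - 1 - (j + 1) = m by omega]
    rw [show m + 1 + (j + 1) - 1 - j = m + 1 by omega] at ih
    set n := m + 1 + (j + 1) with hn
    have hn0 : (0 : ℝ) < n := by positivity
    rw [← Nat.add_assoc, Nat.factorial_succ (n + j), pow_succ]
    rw [Nat.factorial_succ m, pow_succ] at ih
    have hm : (0 : ℝ) < (m : ℝ) + 1 := by positivity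
    have e1 : (n : ℝ) ^ m * n / (((m + 1) * m.factorial : ℕ) : ℝ)
        = ((n : ℝ) ^ m / m.factorial) * (n / (m + 1)) := by
      push_cast
      field_simp
    have e2 : (n : ℝ) ^ (n + j) * n / (((n + j + 1) * (n + j).factorial : ℕ) : ℝ)
        = ((n : ℝ) ^ (n + j) / (n + j).factorial) * (n / (n + j + 1)) := by
      push_cast
      field_simp
    rw [e1] at ih
    rw [e2]
    -- Since `m + 1 = n - (j + 1)`, this is `n ^ 2 - (j + 1) ^ 2 ≤ n ^ 2`.
    have hr : ((m : ℝ) + 1) / n ≤ n / (n + j + 1) := by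
      rw [div_le_div_iff₀ hn0 (by positivity)]
      have : (n : ℝ) = m + 1 + (j + 1) := by rw [hn]; push_cast; ring
      have hj0 : (0 : ℝ) ≤ j := by positivity
      nlinarith
    calc (n : ℝ) ^ m / m.factorial
        = ((n : ℝ) ^ m / m.factorial * (n / (m + 1))) * ((m + 1) / n) := by field_simp
      _ ≤ ((n : ℝ) ^ (n + j) / (n + j).factorial) * (n / (n + j + 1)) := by gcongr

/-- The mean of `Poi(n)` is at most its upper median. -/
lemma half_le_poissonTail_self (n : ℕ) : 1 / 2 ≤ poissonTail n n := by
  -- Reflecting `{0, …, n - 1}` onto `{n, …, 2 * n - 1}` shows that the mass below `n` is at most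
  -- the mass from `n` on.
  have h1 : ∑ i ∈ Finset.range n, (n : ℝ) ^ i / (i.factorial : ℝ) ≤
      ∑ j ∈ Finset.range n, (n : ℝ) ^ (n + j) / ((n + j).factorial : ℝ) := by
    rw [← Finset.sum_range_reflect]
    exact Finset.sum_le_sum fun j hj => pow_div_factorial_le (Finset.mem_range.1 hj)
  have h2 : 0 ≤ poissonTail n (n + n) := poissonTail_nonneg (by positivity) _
  rw [poissonTail, Finset.sum_range_add, mul_add] at h2
  have h3 := mul_le_mul_of_nonneg_left h1 (Real.exp_pos (-(n : ℝ))).le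
  rw [poissonTail]
  linarith

lemma mul_exp_neg_lt {s t : ℝ} (hst : s < t) (ht : t ≤ 1) :
    s * Real.exp (-s) < t * Real.exp (-t) := by
  have hd : ∀ x : ℝ, HasDerivAt (fun x : ℝ => x * Real.exp (-x)) ((1 - x) * Real.exp (-x)) x := by
    intro x
    have : HasDerivAt (fun l : ℝ => Real.exp (-l)) (-Real.exp (-x)) x := by
      simpa using (hasDerivAt_neg x).exp
    refine ((hasDerivAt_id x).mul this).congr_deriv ?_
    simp only [id]
    ring
  refine strictMonoOn_of_deriv_pos (f := fun x : ℝ => x * Real.exp (-x)) (convex_Iic 1)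
    (fun x _ => (hd x).continuousAt.continuousWithinAt) ?_
    (Set.mem_Iic.2 (hst.le.trans ht)) (Set.mem_Iic.2 ht) hst
  intro x hx
  rw [interior_Iic, Set.mem_Iio] at hx
  rw [(hd x).deriv]
  exact mul_pos (by linarith) (Real.exp_pos _)

/-- For `t ≤ 1`, an average of `n + 2` independent standard exponential variables is at most as
likely to be at most `t` as an average of `n + 1` of them. -/
lemma poissonTail_mul_succ_le (n : ℕ) {t : ℝ} (ht0 : 0 ≤ t) (ht1 : t ≤ 1) :
    poissonTail (((n : ℝ) + 2) * t) (n + 2) ≤ poissonTail (((n : ℝ) + 1) * t) (n + 1) := by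
  let D : ℝ → ℝ := fun t =>
    poissonTail (((n : ℝ) + 2) * t) (n + 2) - poissonTail (((n : ℝ) + 1) * t) (n + 1)
  let a : ℝ := ((n : ℝ) + 2) ^ (n + 2) / ((n + 1).factorial : ℝ)
  let b : ℝ := ((n : ℝ) + 1) ^ (n + 1) / (n.factorial : ℝ)
  have ha : 0 < a := by positivity
  have hd : ∀ x, HasDerivAt D
      (Real.exp (-(((n : ℝ) + 1) * x)) * x ^ n * (a * (x * Real.exp (-x)) - b)) x := by
    intro x
    have h1 := (hasDerivAt_poissonTail (n + 1) (((n : ℝ) + 2) * x)).comp x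
      ((hasDerivAt_id x).const_mul ((n : ℝ) + 2))
    have h2 := (hasDerivAt_poissonTail n (((n : ℝ) + 1) * x)).comp x
      ((hasDerivAt_id x).const_mul ((n : ℝ) + 1))
    refine (h1.sub h2).congr_deriv ?_
    have he : Real.exp (-(((n : ℝ) + 2) * x)) =
        Real.exp (-(((n : ℝ) + 1) * x)) * Real.exp (-x) := by
      rw [← Real.exp_add]
      congr 1
      ring
    simp only [he, a, b, mul_pow]
    ring
  have hD0 : D 0 = 0 := by simp [D, poissonTail_zero_succ]
  have hD1 : D 1 ≤ 0 := by
    have := poissonTail_self_succ_le (n + 1)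
    push_cast at this
    simp only [D, mul_one, show (n : ℝ) + 2 = n + 1 + 1 by ring]
    linarith
  suffices D t ≤ 0 by simpa [D] using this
  -- As `D 0 = 0` and `D 1 ≤ 0`, a positive value at `t` forces a positive slope before `t` and a
  -- negative one after. But the sign of the slope is that of `a * (x * exp (-x)) - b`, which
  -- increases on `[0, 1]`.
  by_contra! hpos
  have ht0' : 0 < t := ht0.lt_of_ne (by rintro rfl; linarith)
  have ht1' : t < 1 := ht1.lt_of_ne (by rintro rfl; linarith)
  obtain ⟨c, hc, hc'⟩ := exists_deriv_eq_slope D ht0'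
    (fun x _ => (hd x).continuousAt.continuousWithinAt)
    (fun x _ => (hd x).differentiableAt.differentiableWithinAt)
  obtain ⟨d, hd1, hd'⟩ := exists_deriv_eq_slope D ht1'
    (fun x _ => (hd x).continuousAt.continuousWithinAt)
    (fun x _ => (hd x).differentiableAt.differentiableWithinAt)
  rw [(hd c).deriv] at hc'
  rw [(hd d).deriv] at hd'
  have hcpos : 0 < (D t - D 0) / (t - 0) := div_pos (by linarith) (by linarith)
  have hdneg : (D 1 - D t) / (1 - t) < 0 := div_neg_of_neg_of_pos (by linarith) (by linarith)
  rw [← hc'] at hcpos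
  rw [← hd'] at hdneg
  have hc0 : 0 < Real.exp (-(((n : ℝ) + 1) * c)) * c ^ n := by have := hc.1; positivity
  have hd0 : 0 < Real.exp (-(((n : ℝ) + 1) * d)) * d ^ n := by
    have := ht0'.trans hd1.1; positivity
  have h1 := pos_of_mul_pos_right hcpos hc0.le
  have h2 := neg_of_mul_neg_right hdneg hd0.le
  have h3 := mul_lt_mul_of_pos_left (mul_exp_neg_lt (hc.2.trans hd1.1) hd1.2.le) ha
  linarith

section Quantile

variable {γ : ℝ}

lemma le_poissonQ_iff {n : ℕ} {l : ℝ≥0} : γ ≤ poissonQ n l ↔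
    poissonTail l n ≤ 1 - γ := by
  rw [poissonQ_eq]
  constructor <;> intro h <;> linarith

/-- At rate `k + 1` the tail is already at least `1 / 2 ≥ 1 - γ`; this is where `α ≤ 1 / 2` enters.
The bound keeps the supremum in `poissonQInv` from taking its default value 0. -/
lemma le_of_le_poissonQ (hγ : 1 / 2 ≤ γ) {k : ℕ} {l : ℝ≥0} (hl : γ ≤ poissonQ (k + 1) l) :
    l ≤ (k : ℝ≥0) + 1 := by
  by_contra! h
  have h1 : poissonTail ((k : ℝ) + 1) (k + 1) < poissonTail l (k + 1) :=
    poissonTail_lt (by positivity) (by exact_mod_cast h) k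
  have h2 := half_le_poissonTail_self (k + 1)
  push_cast at h2
  rw [le_poissonQ_iff] at hl
  linarith

lemma bddAbove_poissonQ (hγ : 1 / 2 ≤ γ) (k : ℕ) :
    BddAbove {l : ℝ≥0 | γ ≤ poissonQ (k + 1) l} :=
  ⟨_, fun _ hl => le_of_le_poissonQ hγ hl⟩

lemma le_poissonQInv (hγ : 1 / 2 ≤ γ) {k : ℕ} {l : ℝ} (hl0 : 0 ≤ l)
    (hl : poissonTail l (k + 1) ≤ 1 - γ) : l ≤ poissonQInv (k + 1) γ := by
  lift l to ℝ≥0 using hl0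
  exact NNReal.coe_le_coe.2
    (le_csSup (bddAbove_poissonQ hγ k) (le_poissonQ_iff.2 hl))

lemma poissonQInv_le (hγ : 1 / 2 ≤ γ) (k : ℕ) : poissonQInv (k + 1) γ ≤ k + 1 := by
  have : sSup {l : ℝ≥0 | γ ≤ poissonQ (k + 1) l} ≤ (k : ℝ≥0) + 1 :=
    csSup_le' fun _ hl => le_of_le_poissonQ hγ hl
  exact_mod_cast this

/-- The supremum is attained, the set being closed, bounded and containing 0. -/
lemma poissonTail_poissonQInv_le (hγ : 1 / 2 ≤ γ) (hγ' : γ ≤ 1) (k : ℕ) :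
    poissonTail (poissonQInv (k + 1) γ) (k + 1) ≤ 1 - γ := by
  have hne : {l : ℝ≥0 | γ ≤ poissonQ (k + 1) l}.Nonempty :=
    ⟨0, by simpa [le_poissonQ_iff, poissonTail_zero_succ] using hγ'⟩
  have hcl : IsClosed {l : ℝ≥0 | γ ≤ poissonQ (k + 1) l} := by
    simp_rw [le_poissonQ_iff]
    have hc : Continuous fun l : ℝ => poissonTail l (k + 1) :=
      continuous_iff_continuousAt.2 fun x => (hasDerivAt_poissonTail k x).continuousAt
    exact isClosed_le (hc.comp NNReal.continuous_coe) continuous_const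
  exact le_poissonQ_iff.1 (hcl.csSup_mem hne (bddAbove_poissonQ hγ k))

lemma poissonQInv_pos (hγ : 1 / 2 ≤ γ) (hγ' : γ < 1) (k : ℕ) : 0 < poissonQInv (k + 1) γ := by
  -- At rate `-log γ` the value 0 alone has probability `γ`.
  have h0 : 0 < -Real.log γ := by
    have := Real.log_neg (by linarith) hγ'
    linarith
  refine h0.trans_le (le_poissonQInv hγ h0.le ?_)
  have h1 : ∀ j, poissonTail (-Real.log γ) (j + 1) ≤ 1 - γ := by
    intro j
    induction j with
    | zero => simp [poissonTail, Real.exp_log (show 0 < γ by linarith)]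
    | succ j ih =>
      rw [poissonTail_succ]
      have : 0 ≤ Real.exp (- -Real.log γ) * ((-Real.log γ) ^ (j + 1) / ((j + 1).factorial : ℝ)) := by
        positivity
      linarith
  exact h1 k

/-- The normalized quantiles `Q⁻¹(k + 1, γ) / (k + 1)` are nondecreasing in `k`. -/
lemma monotone_poissonQInv_div (hγ : 1 / 2 ≤ γ) (hγ' : γ ≤ 1) :
    Monotone fun k : ℕ => poissonQInv (k + 1) γ / ((k : ℝ) + 1) := by
  refine monotone_nat_of_le_succ fun k => ?_
  -- It suffices that the rate `(k + 2) * t` is still admissible for index `k + 2`.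
  set t := poissonQInv (k + 1) γ / ((k : ℝ) + 1) with ht
  have hk : (0 : ℝ) < (k : ℝ) + 1 := by positivity
  have h0 : 0 ≤ t := div_nonneg (NNReal.coe_nonneg _) hk.le
  have h1 : t ≤ 1 := (div_le_one hk).2 (poissonQInv_le hγ k)
  have h2 : ((k : ℝ) + 1) * t = poissonQInv (k + 1) γ := by rw [ht]; field_simp
  have h3 := poissonTail_mul_succ_le k h0 h1
  rw [h2] at h3
  have h4 := le_poissonQInv hγ (by positivity) (h3.trans (poissonTail_poissonQInv_le hγ hγ' k))
  rw [le_div_iff₀ (by positivity)]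
  push_cast
  linarith

end Quantile

/-! ### Poisson domination of bins of standard items -/

/-- Each item adds at most 1 to `k` times the content, so content above `t` needs more than `k * t ≥
j - 1` nonzero items, hence at least `j`. A Bernoulli variable of parameter `p` is dominated by a
Poisson variable of rate `log (1 / (1 - p))`, which has the same probability of being 0. -/
lemma tailProb_le_poissonTail {n : ℕ} (X : Fin n → Item) {k : ℕ} (hk : 0 < k)
    (B : Finset (Fin n))
    (hsize : ∀ i ∈ B, k * (X i).size ≤ 1) (hprob : ∀ i ∈ B, ((X i).prob : ℝ) < 1) :
    ∀ (j : ℕ) (t : ℝ), (j : ℝ) ≤ k * t + 1 →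
      tailProb X B t ≤ poissonTail (∑ i ∈ B, Real.log (1 / (1 - (X i).prob))) j := by
  induction B using Finset.induction_on with
  | empty =>
    intro j t hj
    cases j with
    | zero => simpa using tailProb_le_one X ∅ t
    | succ j =>
      have hkt : 0 ≤ (k : ℝ) * t := by
        push_cast at hj
        linarith [(Nat.cast_nonneg j : (0 : ℝ) ≤ j)]
      rw [tailProb_empty, Finset.sum_empty, poissonTail_zero_succ]
      split_ifs with ht
      · have : (0 : ℝ) < k := by exact_mod_cast hk
        nlinarith
      · exact le_rfl
  | insert i B hi ih =>
    intro j t hj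
    cases j with
    | zero => simpa using tailProb_le_one X _ t
    | succ j =>
      have ih := ih (fun i hi => hsize i (Finset.mem_insert_of_mem hi))
        (fun i hi => hprob i (Finset.mem_insert_of_mem hi))
      have hsi := hsize i (Finset.mem_insert_self i B)
      have hpi := hprob i (Finset.mem_insert_self i B)
      rw [tailProb_insert X hi, Finset.sum_insert hi, add_comm (Real.log _)]
      have hnn : ∀ i, ((X i).prob : ℝ) < 1 → 0 ≤ Real.log (1 / (1 - (X i).prob)) := fun i h =>
        Real.log_nonneg ((one_le_div (by linarith)).2 (by linarith [(X i).prob.2.1]))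
      have hexp : Real.exp (-Real.log (1 / (1 - (X i).prob))) = 1 - (X i).prob := by
        rw [one_div, Real.log_inv, neg_neg, Real.exp_log (by linarith)]
      refine le_trans ?_ (poissonTail_add_bernoulli_le (Finset.sum_nonneg fun i hi =>
        hnn i (hprob i (Finset.mem_insert_of_mem hi))) (hnn i hpi) j)
      rw [hexp, sub_sub_cancel]
      have h0 := (X i).prob.2.1
      have h0' : (0 : ℝ) ≤ 1 - (X i).prob := by linarith
      push_cast at hj
      have h1 := ih j (t - (X i).size) (by linarith)
      have h2 := ih (j + 1) t (by push_cast; exact hj)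
      gcongr

/-! ### First Fit -/

section FirstFit

variable {n : ℕ} {fits : Finset (Fin n) → Prop} {i : Fin n}

lemma mem_firstFit {L : List (Finset (Fin n))} {B : Finset (Fin n)} (h : B ∈ firstFit fits i L) :
    B ∈ L ∨ B = {i} ∨ ∃ A ∈ L, B = insert i A ∧ fits B := by
  induction L with
  | nil => simpa [firstFit] using h
  | cons A L ih =>
    rw [firstFit] at h
    split_ifs at h with hA
    · rcases List.mem_cons.1 h with rfl | h
      · exact Or.inr (Or.inr ⟨A, List.mem_cons_self, rfl, hA⟩)
      · exact Or.inl (List.mem_cons_of_mem _ h)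
    · rcases List.mem_cons.1 h with rfl | h
      · exact Or.inl List.mem_cons_self
      · rcases ih h with h | h | ⟨A', hA', h⟩
        · exact Or.inl (List.mem_cons_of_mem _ h)
        · exact Or.inr (Or.inl h)
        · exact Or.inr (Or.inr ⟨A', List.mem_cons_of_mem _ hA', h⟩)

lemma exists_mem_firstFit_iff (L : List (Finset (Fin n))) (j : Fin n) :
    (∃ B ∈ firstFit fits i L, j ∈ B) ↔ j = i ∨ ∃ B ∈ L, j ∈ B := by
  induction L with
  | nil => simp [firstFit]
  | cons A L ih =>
    rw [firstFit]
    split_ifs with hA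
    · simp [or_assoc]
    · simp only [List.exists_mem_cons_iff, ih]
      tauto

lemma pairwise_disjoint_firstFit {L : List (Finset (Fin n))} (hL : L.Pairwise Disjoint)
    (hi : ∀ B ∈ L, i ∉ B) : (firstFit fits i L).Pairwise Disjoint := by
  induction L with
  | nil => simp [firstFit]
  | cons A L ih =>
    rw [List.pairwise_cons] at hL
    have hi' : ∀ B ∈ L, i ∉ B := fun B hB => hi B (List.mem_cons_of_mem _ hB)
    have hiA := hi A List.mem_cons_self
    rw [firstFit]
    split_ifs with hA
    · refine List.pairwise_cons.2 ⟨fun B hB => ?_, hL.2⟩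
      exact Finset.disjoint_insert_left.2 ⟨hi' B hB, hL.1 B hB⟩
    · refine List.pairwise_cons.2 ⟨fun B hB => ?_, ih hL.2 hi'⟩
      rcases mem_firstFit hB with h | rfl | ⟨A', hA', rfl, -⟩
      · exact hL.1 B h
      · simpa using hiA
      · exact Finset.disjoint_insert_right.2 ⟨hiA, hL.1 A' hA'⟩

lemma sum_firstFit (w : Fin n → ℝ) {L : List (Finset (Fin n))} (hi : ∀ B ∈ L, i ∉ B) :
    ((firstFit fits i L).map fun B => ∑ j ∈ B, w j).sum =
      (L.map fun B => ∑ j ∈ B, w j).sum + w i := by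
  induction L with
  | nil => simp [firstFit]
  | cons A L ih =>
    have hi' : ∀ B ∈ L, i ∉ B := fun B hB => hi B (List.mem_cons_of_mem _ hB)
    rw [firstFit]
    split_ifs with hA
    · simp only [List.map_cons, List.sum_cons, Finset.sum_insert (hi A List.mem_cons_self)]
      ring
    · simp only [List.map_cons, List.sum_cons, ih hi']
      ring

/-- If every content of weight at most `1` fits, any two bins of First Fit have total weight
larger than `1`. -/
lemma pairwise_one_lt_firstFit {w : Fin n → ℝ} (hw : 0 ≤ w i)
    (hfits : ∀ B, ∑ j ∈ B, w j ≤ 1 → fits B) {L : List (Finset (Fin n))}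
    (hL : L.Pairwise fun A B => 1 < ∑ j ∈ A, w j + ∑ j ∈ B, w j) (hi : ∀ B ∈ L, i ∉ B) :
    (firstFit fits i L).Pairwise fun A B => 1 < ∑ j ∈ A, w j + ∑ j ∈ B, w j := by
  induction L with
  | nil => simp [firstFit]
  | cons A L ih =>
    rw [List.pairwise_cons] at hL
    have hi' : ∀ B ∈ L, i ∉ B := fun B hB => hi B (List.mem_cons_of_mem _ hB)
    have hiA := hi A List.mem_cons_self
    rw [firstFit]
    split_ifs with hA
    · refine List.pairwise_cons.2 ⟨fun B hB => ?_, hL.2⟩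
      rw [Finset.sum_insert hiA]
      linarith [hL.1 B hB]
    · refine List.pairwise_cons.2 ⟨fun B hB => ?_, ih hL.2 hi'⟩
      rcases mem_firstFit hB with h | rfl | ⟨A', hA', rfl, -⟩
      · exact hL.1 B h
      -- The new bin `{i}` was opened because `insert i A` failed the test.
      · have : 1 < ∑ j ∈ insert i A, w j := not_le.1 fun h => hA (hfits _ h)
        rw [Finset.sum_insert hiA] at this
        rw [Finset.sum_singleton]
        linarith
      · rw [Finset.sum_insert (hi' A' hA')]
        linarith [hL.1 A' hA']

end FirstFit

/-- If any two of the given weights sum up to more than `1`, then at most one of them is less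
than `1 / 2`. -/
lemma length_le_of_pairwise_one_lt {β : Type*} {W : β → ℝ} {L : List β}
    (hL : L.Pairwise fun a b => 1 < W a + W b) (hW : ∀ a ∈ L, 0 ≤ W a) :
    (L.length : ℝ) ≤ 2 * (L.map W).sum + 1 := by
  induction L with
  | nil => simp
  | cons a L ih =>
    rw [List.pairwise_cons] at hL
    have hW' : ∀ b ∈ L, 0 ≤ W b := fun b hb => hW b (List.mem_cons_of_mem _ hb)
    have ih := ih hL.2 hW'
    simp only [List.length_cons, List.map_cons, List.sum_cons]
    push_cast
    rcases le_or_gt (1 / 2) (W a) with ha | ha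
    · linarith
    -- If `a` is lighter than `1 / 2`, every other bin is heavier, and the summand 1 pays for `a`.
    · have h : (L.map fun _ => (1 / 2 : ℝ)).sum ≤ (L.map W).sum :=
        List.sum_le_sum fun b hb => by linarith [hL.1 b hb]
      rw [List.map_const', List.sum_replicate, nsmul_eq_mul] at h
      linarith [hW a List.mem_cons_self]

/-! ### Scaling factors and weights -/

/-- The standing assumptions on the parameters. -/
structure Params.Valid (P : Params) : Prop where
  α_pos : 0 < P.α
  α_le : P.α ≤ 1 / 2
  sMax_le : P.sMax ≤ 1
  sMin_pos : 0 < P.sMin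
  sMin_lt : P.sMin < P.sMax
  pMax_pos : 0 < P.pMax
  pMax_lt : P.pMax < 1

namespace Params

lemma two_muMin_le_pMax (P : Params) : 2 * P.muMin ≤ P.pMax := by
  have := min_le_left P.pMax (min P.mu0 ((1 - P.pMax) * P.lamMin))
  rw [Params.muMin]
  linarith

lemma two_muMin_le_mu0 (P : Params) : 2 * P.muMin ≤ P.mu0 := by
  have := (min_le_right P.pMax (min P.mu0 ((1 - P.pMax) * P.lamMin))).trans (min_le_left _ _)
  rw [Params.muMin]
  linarith

lemma two_muMin_le_lamMin (P : Params) : 2 * P.muMin ≤ (1 - P.pMax) * P.lamMin := by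
  have := (min_le_right P.pMax (min P.mu0 ((1 - P.pMax) * P.lamMin))).trans (min_le_right _ _)
  rw [Params.muMin]
  linarith

lemma kMin_le_floor (P : Params) {x : Item} (hx : 0 < x.size) (hx' : x.size ≤ P.sMax) :
    P.kMin ≤ ⌊1 / x.size⌋₊ :=
  Nat.floor_mono (one_div_le_one_div_of_le hx hx')

end Params

namespace Params.Valid

variable {P : Params}

/-- The scaling factor is the root below 1 of the equation saying that Chebyshev's bound `sMin * m /
(1 - m) ^ 2` at mean `m` equals `α`. -/
lemma mu0_quadratic (hP : P.Valid) : P.α * (1 - P.mu0) ^ 2 = P.sMin * P.mu0 := by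
  have h1 := hP.α_pos
  have h2 := hP.sMin_pos
  have hr := Real.sq_sqrt (show 0 ≤ P.sMin ^ 2 + 4 * P.α * P.sMin by positivity)
  unfold Params.mu0
  set r := Real.sqrt (P.sMin ^ 2 + 4 * P.α * P.sMin)
  field_simp
  linear_combination hr

lemma mu0_lt_one (hP : P.Valid) : P.mu0 < 1 := by
  have h1 := hP.α_pos
  have h2 := hP.sMin_pos
  have : P.sMin < Real.sqrt (P.sMin ^ 2 + 4 * P.α * P.sMin) :=
    Real.lt_sqrt_of_sq_lt (by nlinarith)
  unfold Params.mu0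
  rw [div_lt_one (by positivity)]
  linarith

lemma mu0_pos (hP : P.Valid) : 0 < P.mu0 := by
  have h1 := hP.mu0_quadratic
  have h2 := hP.mu0_lt_one
  have h3 : 0 < P.α * (1 - P.mu0) ^ 2 := mul_pos hP.α_pos (by nlinarith)
  rw [h1] at h3
  exact pos_of_mul_pos_right h3 hP.sMin_pos.le

lemma lam_pos (hP : P.Valid) (k : ℕ) : 0 < P.lam k :=
  poissonQInv_pos (by linarith [hP.α_le]) (by linarith [hP.α_pos]) k

lemma lamMin_le (hP : P.Valid) {k : ℕ} (hk : P.kMin ≤ k) : P.lamMin ≤ P.lam k / (k + 1) := by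
  have := monotone_poissonQInv_div (γ := 1 - P.α) (by linarith [hP.α_le])
    (by linarith [hP.α_pos]) hk
  rw [Params.lamMin, one_div_mul_eq_div]
  exact this

lemma lamMin_pos (hP : P.Valid) : 0 < P.lamMin := by
  rw [Params.lamMin]
  have := hP.lam_pos ⌊1 / P.sMax⌋₊
  rw [Params.lam] at this
  positivity

lemma muMin_pos (hP : P.Valid) : 0 < P.muMin := by
  have h1 := hP.mu0_pos
  have h2 := hP.lamMin_pos
  have h3 : 0 < 1 - P.pMax := by linarith [hP.pMax_lt]
  have h4 := hP.pMax_pos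
  rw [Params.muMin]
  positivity

lemma weight_nonneg (hP : P.Valid) (g : Group) {x : Item} (hx : 0 ≤ x.size) : 0 ≤ weight P g x := by
  have hp0 := x.prob.2.1
  have hp1 := x.prob.2.2
  cases g with
  | confident => exact hx
  | minor => exact div_nonneg (mul_nonneg hp0 hx) hP.mu0_pos.le
  | standard k =>
    refine div_nonneg ?_ (hP.lam_pos k).le
    rw [one_div, Real.log_inv, neg_nonneg]
    exact Real.log_nonpos (by linarith) (by linarith)

lemma floor_le_kMax (hP : P.Valid) {x : Item} (hx : P.sMin < x.size) : ⌊1 / x.size⌋₊ ≤ P.kMax := by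
  have hx0 := hP.sMin_pos.trans hx
  -- Strictness, from `sMin < x.size`, accounts for the `- 1` in `kMax`.
  have h : (⌊1 / x.size⌋₊ : ℝ) < ⌈1 / P.sMin⌉₊ :=
    ((Nat.floor_le (by positivity)).trans_lt (one_div_lt_one_div_of_lt hP.sMin_pos hx)).trans_le
      (Nat.le_ceil _)
  have h' : ⌊1 / x.size⌋₊ < ⌈1 / P.sMin⌉₊ := by exact_mod_cast h
  unfold Params.kMax
  omega

lemma kMin_le_kMax (hP : P.Valid) : P.kMin ≤ P.kMax :=
  hP.floor_le_kMax (x := ⟨P.sMax, 0⟩) hP.sMin_lt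

/-- The weight of an item is at most a multiple of its mean size. -/
lemma weight_le (hP : P.Valid) {x : Item} (hx : 0 < x.size) (hx' : x.size ≤ P.sMax) :
    weight P (groupOf P x) x ≤ x.prob * x.size / (2 * P.muMin) := by
  have hp0 := x.prob.2.1
  have hm := hP.muMin_pos
  have hps : 0 ≤ x.prob * x.size := mul_nonneg hp0 hx.le
  unfold groupOf
  split_ifs with h1 h2
  · rw [weight, le_div_iff₀ (by positivity)]
    have := P.two_muMin_le_pMax
    nlinarith
  · exact div_le_div_of_nonneg_left hps (by positivity) P.two_muMin_le_mu0
  · set k := ⌊1 / x.size⌋₊ with hk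
    have hpm : 0 < 1 - P.pMax := by linarith [hP.pMax_lt]
    have hp1 : 0 < 1 - (x.prob : ℝ) := by linarith [hP.pMax_lt]
    have hlam := hP.lam_pos k
    have hlog : Real.log (1 / (1 - x.prob)) ≤ x.prob / (1 - P.pMax) := by
      calc Real.log (1 / (1 - x.prob)) ≤ 1 / (1 - x.prob) - 1 :=
            Real.log_le_sub_one_of_pos (by positivity)
        _ = x.prob / (1 - x.prob) := by field_simp; ring
        _ ≤ x.prob / (1 - P.pMax) := by
            apply div_le_div_of_nonneg_left hp0 hpm
            linarith
    -- Subgroup `k` has sizes at least `1 / (k + 1)`, which turns the probability into a mean size.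
    have hsize : 1 ≤ x.size * (k + 1) := by
      have := Nat.lt_floor_add_one (1 / x.size)
      rw [div_lt_iff₀ hx] at this
      rw [mul_comm]
      exact this.le
    have hmu : 2 * P.muMin ≤ (1 - P.pMax) * (P.lam k / (k + 1)) :=
      P.two_muMin_le_lamMin.trans
        (mul_le_mul_of_nonneg_left (hP.lamMin_le (P.kMin_le_floor hx hx')) hpm.le)
    calc Real.log (1 / (1 - x.prob)) / P.lam k
        ≤ x.prob / (1 - P.pMax) / P.lam k := by gcongr
      _ = x.prob * 1 / ((1 - P.pMax) * P.lam k) := by field_simp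
      _ ≤ x.prob * (x.size * (k + 1)) / ((1 - P.pMax) * P.lam k) := by gcongr
      _ = x.prob * x.size / ((1 - P.pMax) * (P.lam k / (k + 1))) := by field_simp
      _ ≤ x.prob * x.size / (2 * P.muMin) :=
          div_le_div_of_nonneg_left hps (by positivity) hmu

end Params.Valid

/-! ### Viability of the two tests -/

section Viable

variable {P : Params} {n : ℕ} {X : Fin n → Item}

lemma groupOf_eq_minor {x : Item} (h : groupOf P x = .minor) : x.size ≤ P.sMin := by
  unfold groupOf at h
  split_ifs at h with h1 h2
  exact h2

lemma groupOf_eq_standard {x : Item} {k : ℕ} (h : groupOf P x = .standard k) :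
    x.prob ≤ P.pMax ∧ P.sMin < x.size ∧ ⌊1 / x.size⌋₊ = k := by
  unfold groupOf at h
  split_ifs at h with h1 h2
  exact ⟨not_lt.1 h1, not_le.1 h2, Group.standard.inj h⟩

lemma overflowProb_le_of_rpapFits (hP : P.Valid) (hs : ∀ i, 0 < (X i).size)
    (hs' : ∀ i, (X i).size ≤ P.sMax) {g : Group} {B : Finset (Fin n)}
    (hB : ∀ i ∈ B, groupOf P (X i) = g) (h : rpapFits P X g B) : overflowProb X B ≤ P.α := by
  rw [overflowProb_eq_tailProb]
  unfold rpapFits at h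
  cases g with
  | confident =>
    rw [tailProb_eq_zero_of_sum_size_le X (fun i => (hs i).le) B 1 h]
    exact hP.α_pos.le
  | minor =>
    simp only [weight, ← Finset.sum_div] at h
    rw [div_le_one hP.mu0_pos] at h
    set m := ∑ i ∈ B, ((X i).prob : ℝ) * (X i).size with hm
    have hm1 : m < 1 := h.trans_lt hP.mu0_lt_one
    have hcheb := tailProb_mul_sq_le X B 1 m hm1.le
    rw [← hm, sub_self, zero_pow two_ne_zero, add_zero] at hcheb
    have hV : ∑ i ∈ B, ((X i).prob * (1 - (X i).prob) * (X i).size ^ 2 : ℝ) ≤ P.sMin * m := by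
      rw [hm, Finset.mul_sum]
      refine Finset.sum_le_sum fun i hi => ?_
      have h0 := (X i).prob.2.1
      have hps := mul_nonneg h0 (hs i).le
      have hsm := groupOf_eq_minor (hB i hi)
      have h1 : (1 - ((X i).prob : ℝ)) * (X i).size ≤ P.sMin := by
        nlinarith [hs i]
      calc ((X i).prob * (1 - (X i).prob) * (X i).size ^ 2 : ℝ)
          = (1 - ((X i).prob : ℝ)) * (X i).size * ((X i).prob * (X i).size) := by ring
        _ ≤ _ := mul_le_mul_of_nonneg_right h1 hps
    have hq : P.sMin * m ≤ P.α * (1 - m) ^ 2 :=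
      calc P.sMin * m ≤ P.sMin * P.mu0 := mul_le_mul_of_nonneg_left h hP.sMin_pos.le
        _ = P.α * (1 - P.mu0) ^ 2 := hP.mu0_quadratic.symm
        _ ≤ P.α * (1 - m) ^ 2 := by
          have := hP.mu0_lt_one
          have := hP.α_pos
          gcongr
    exact le_of_mul_le_mul_right ((hcheb.trans hV).trans hq) (pow_pos (by linarith) 2)
  | standard k =>
    simp only [weight, ← Finset.sum_div] at h
    rw [div_le_one (hP.lam_pos k)] at h
    -- Only an actual item, of size at most 1, guarantees `0 < k`.
    rcases B.eq_empty_or_nonempty with rfl | ⟨i₀, hi₀⟩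
    · rw [tailProb_empty]
      simpa [not_lt.2 zero_le_one] using hP.α_pos.le
    have hB' := fun i hi => groupOf_eq_standard (hB i hi)
    have hk : 0 < k := by
      rw [← (hB' i₀ hi₀).2.2]
      exact Nat.floor_pos.2 ((one_le_div (hs i₀)).2 ((hs' i₀).trans hP.sMax_le))
    have hsize : ∀ i ∈ B, k * (X i).size ≤ 1 := fun i hi => by
      rw [← le_div_iff₀ (hs i), ← (hB' i hi).2.2]
      exact Nat.floor_le (one_div_nonneg.2 (hs i).le)
    have hprob : ∀ i ∈ B, ((X i).prob : ℝ) < 1 := fun i hi => (hB' i hi).1.trans_lt hP.pMax_lt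
    have hlog : 0 ≤ ∑ i ∈ B, Real.log (1 / (1 - (X i).prob)) :=
      Finset.sum_nonneg fun i hi => Real.log_nonneg
        ((one_le_div (by linarith [hprob i hi])).2 (by linarith [(X i).prob.2.1]))
    calc tailProb X B 1 ≤ poissonTail (∑ i ∈ B, Real.log (1 / (1 - (X i).prob))) (k + 1) :=
          tailProb_le_poissonTail X hk B hsize hprob _ _ (by push_cast; linarith)
      _ ≤ poissonTail (P.lam k) (k + 1) := poissonTail_mono hlog h _
      _ ≤ 1 - (1 - P.α) :=
          poissonTail_poissonQInv_le (by linarith [hP.α_le]) (by linarith [hP.α_pos]) k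
      _ = P.α := by ring

lemma overflowProb_le_of_ffrFits {ε : ℝ} (hε : 0 < ε) {B : Finset (Fin n)}
    (h : ffrFits P ε X B) : overflowProb X B ≤ P.α := by
  refine le_trans ?_ h
  refine tailProb_mono_size (X := X) (Y := fun i => (X i).roundUp ε) (fun i => rfl) (fun i => ?_) B 1
  rw [Item.roundUp, ← div_le_iff₀ hε]
  exact Nat.le_ceil _

/-- The mean content of a viable bin. -/
lemma sum_mean_le_of_overflowProb_le (hP : P.Valid) (hs : ∀ i, 0 ≤ (X i).size)
    (hs' : ∀ i, (X i).size ≤ 1) {B : Finset (Fin n)} (hB : overflowProb X B ≤ P.α) :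
    ∑ i ∈ B, (X i).prob * (X i).size ≤ (1 + P.α) / (1 - P.α) := by
  -- With `M` the mean `m` itself this reads `m ≤ 1 + (1 + m) * α`.
  have h := sum_mean_le X hs hs' B le_rfl 1 zero_le_one
  set m := ∑ i ∈ B, ((X i).prob : ℝ) * (X i).size
  have hm : 0 ≤ m := Finset.sum_nonneg fun i _ => mul_nonneg (X i).prob.2.1 (hs i)
  have hα := hP.α_le
  have h2 := mul_le_mul_of_nonneg_left hB (show 0 ≤ 1 + m by linarith)
  rw [overflowProb_eq_tailProb] at h2
  rw [le_div_iff₀ (by linarith)]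
  linarith

end Viable

/-! ### The bins of RPAPC -/

section RPAPC

variable {P : Params} {n : ℕ} {X : Fin n → Item} {ε : ℝ}

/-- The invariant of the list `L` of bins of group `g` after the items in `S` have been packed. -/
structure GroupInvariant (P : Params) (X : Fin n → Item) (S : Finset (Fin n)) (g : Group)
    (L : List (Finset (Fin n))) : Prop where
  disjoint : L.Pairwise Disjoint
  mem_iff : ∀ j, (∃ B ∈ L, j ∈ B) ↔ j ∈ S ∧ groupOf P (X j) = g
  viable : ∀ B ∈ L, overflowProb X B ≤ P.α
  one_lt : L.Pairwise fun A B => 1 < ∑ j ∈ A, weight P g (X j) + ∑ j ∈ B, weight P g (X j)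
  sum_eq : (L.map fun B => ∑ j ∈ B, weight P g (X j)).sum =
    ∑ j ∈ S with groupOf P (X j) = g, weight P g (X j)

lemma groupInvariant_nil (g : Group) : GroupInvariant P X ∅ g [] where
  disjoint := List.Pairwise.nil
  mem_iff := by simp
  viable := by simp
  one_lt := List.Pairwise.nil
  sum_eq := by simp

/-- Viability needs each test to be sound by itself, while `one_lt` needs only that passing the RPAP
test suffices for acceptance. The extra First Fit Rounded test therefore cannot spoil the count. -/
lemma GroupInvariant.step (hP : P.Valid) (hε : 0 < ε) (hs : ∀ i, 0 < (X i).size)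
    (hs' : ∀ i, (X i).size ≤ P.sMax) {S : Finset (Fin n)}
    {state : Group → List (Finset (Fin n))} (h : ∀ g, GroupInvariant P X S g (state g))
    {i : Fin n} (hi : i ∉ S) (g : Group) :
    GroupInvariant P X (insert i S) g (rpapcStep P ε X state i g) := by
  have h := h g
  by_cases hg : groupOf P (X i) = g
  · have hstep : rpapcStep P ε X state i g =
        firstFit (fun B => rpapFits P X g B ∨ ffrFits P ε X B) i (state g) := by
      simp only [rpapcStep, hg, Function.update_self]
    rw [hstep]
    have hiL : ∀ B ∈ state g, i ∉ B := fun B hB hiB => hi ((h.mem_iff i).1 ⟨B, hB, hiB⟩).1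
    refine ⟨pairwise_disjoint_firstFit h.disjoint hiL, fun j => ?_, fun B hB => ?_,
      pairwise_one_lt_firstFit (hP.weight_nonneg g (hs i).le) (fun B hB => Or.inl hB)
        h.one_lt hiL, ?_⟩
    · rw [exists_mem_firstFit_iff, h.mem_iff, Finset.mem_insert]
      constructor
      · rintro (rfl | ⟨h1, h2⟩)
        exacts [⟨Or.inl rfl, hg⟩, ⟨Or.inr h1, h2⟩]
      · rintro ⟨h1 | h1, h2⟩
        exacts [Or.inl h1, Or.inr ⟨h1, h2⟩]
    · rcases mem_firstFit hB with hB | rfl | ⟨A, hA, rfl, hfit | hfit⟩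
      · exact h.viable B hB
      · rw [overflowProb_eq_tailProb, tailProb_eq_zero_of_sum_size_le X (fun i => (hs i).le)]
        · exact hP.α_pos.le
        · simpa using (hs' i).trans hP.sMax_le
      · refine overflowProb_le_of_rpapFits hP hs hs' (fun j hj => ?_) hfit
        rcases Finset.mem_insert.1 hj with rfl | hj
        · exact hg
        · exact ((h.mem_iff j).1 ⟨A, hA, hj⟩).2
      · exact overflowProb_le_of_ffrFits hε hfit
    · rw [sum_firstFit _ hiL, h.sum_eq, Finset.filter_insert, if_pos hg,
        Finset.sum_insert (by simp [hi]), add_comm]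
  · have hstep : rpapcStep P ε X state i g = state g := by
      simp only [rpapcStep]
      exact Function.update_of_ne (Ne.symm hg) _ _
    rw [hstep]
    refine ⟨h.disjoint, fun j => ?_, h.viable, h.one_lt, ?_⟩
    · rw [h.mem_iff, Finset.mem_insert]
      constructor
      · rintro ⟨h1, h2⟩
        exact ⟨Or.inr h1, h2⟩
      · rintro ⟨rfl | h1, h2⟩
        exacts [absurd h2 hg, ⟨h1, h2⟩]
    · rw [h.sum_eq, Finset.filter_insert, if_neg hg]

lemma groupInvariant_foldl (hP : P.Valid) (hε : 0 < ε) (hs : ∀ i, 0 < (X i).size)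
    (hs' : ∀ i, (X i).size ≤ P.sMax) (l : List (Fin n)) (hl : l.Nodup) (g : Group) :
    GroupInvariant P X l.toFinset g (l.foldl (rpapcStep P ε X) (fun _ => []) g) := by
  induction l using List.reverseRecOn generalizing g with
  | nil => exact groupInvariant_nil g
  | append_singleton l i ih =>
    have hl' := List.nodup_append.1 hl
    have hi : i ∉ l.toFinset := by
      rw [List.mem_toFinset]
      exact fun h => hl'.2.2 i h i (List.mem_singleton_self i) rfl
    have := GroupInvariant.step hP hε hs hs' (fun g => ih hl'.1 g) hi g
    have hS : (l ++ [i]).toFinset = insert i l.toFinset := by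
      ext j
      simp
    rw [List.foldl_append, hS]
    exact this

lemma groupInvariant_rpapcState (hP : P.Valid) (hε : 0 < ε) (hs : ∀ i, 0 < (X i).size)
    (hs' : ∀ i, (X i).size ≤ P.sMax) (g : Group) :
    GroupInvariant P X Finset.univ g (rpapcState P ε X g) := by
  have := groupInvariant_foldl hP hε hs hs' (List.finRange n) (List.nodup_finRange n) g
  rwa [List.toFinset_finRange] at this

/-- The list of the groups whose bins are returned by RPAPC. -/
noncomputable def groupList (P : Params) : List Group :=
  .confident :: .minor :: (List.range' P.kMin (P.kMax + 1 - P.kMin)).map .standard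

lemma rpapc_eq_flatMap : rpapc P ε X = (groupList P).flatMap (rpapcState P ε X) := by
  simp [rpapc, groupList, List.flatMap_map]

lemma nodup_groupList : (groupList P).Nodup := by
  have h : ((List.range' P.kMin (P.kMax + 1 - P.kMin)).map Group.standard).Nodup :=
    List.Nodup.map (fun a b hab => Group.standard.inj hab) List.nodup_range'
  simp [groupList, h]

lemma length_groupList (hP : P.Valid) :
    ((groupList P).length : ℝ) = (P.kMax : ℝ) - P.kMin + 3 := by
  have h := hP.kMin_le_kMax
  have : (groupList P).length + P.kMin = P.kMax + 3 := by
    simp [groupList]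
    omega
  have : ((groupList P).length : ℝ) + P.kMin = P.kMax + 3 := by exact_mod_cast this
  linarith

lemma groupOf_mem_groupList (hP : P.Valid) {x : Item} (hx : 0 < x.size) (hx' : x.size ≤ P.sMax) :
    groupOf P x ∈ groupList P := by
  unfold groupOf
  split_ifs with h1 h2
  · simp [groupList]
  · simp [groupList]
  · have h3 := P.kMin_le_floor hx hx'
    have h4 := hP.floor_le_kMax (not_le.1 h2)
    simp only [groupList, List.mem_cons, List.mem_map, List.mem_range'_1]
    exact Or.inr (Or.inr ⟨_, by omega, rfl⟩)

lemma isViablePacking_rpapc (hP : P.Valid) (hε : 0 < ε) (hs : ∀ i, 0 < (X i).size)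
    (hs' : ∀ i, (X i).size ≤ P.sMax) : IsViablePacking P.α X (rpapc P ε X) := by
  have hinv := groupInvariant_rpapcState hP hε hs hs'
  rw [rpapc_eq_flatMap]
  refine ⟨?_, fun i => ?_, fun B hB => ?_⟩
  · refine List.pairwise_flatMap.2 ⟨fun g _ => (hinv g).disjoint, ?_⟩
    refine nodup_groupList.imp fun {g g'} hgg' A hA B hB => ?_
    refine Finset.disjoint_left.2 fun j hj hj' => hgg' ?_
    rw [← (((hinv g).mem_iff j).1 ⟨A, hA, hj⟩).2, (((hinv g').mem_iff j).1 ⟨B, hB, hj'⟩).2]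
  · obtain ⟨B, hB, hi⟩ := ((hinv (groupOf P (X i))).mem_iff i).2 ⟨Finset.mem_univ i, rfl⟩
    exact ⟨B, List.mem_flatMap.2 ⟨_, groupOf_mem_groupList hP (hs i) (hs' i), hB⟩, hi⟩
  · obtain ⟨g, -, hB⟩ := List.mem_flatMap.1 hB
    exact (hinv g).viable B hB

lemma length_rpapc_le (hP : P.Valid) (hε : 0 < ε) (hs : ∀ i, 0 < (X i).size)
    (hs' : ∀ i, (X i).size ≤ P.sMax) :
    ((rpapc P ε X).length : ℝ) ≤
      2 * ∑ i, weight P (groupOf P (X i)) (X i) + (P.kMax - P.kMin + 3) := by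
  have hinv := groupInvariant_rpapcState hP hε hs hs'
  have hlen : ∀ g, ((rpapcState P ε X g).length : ℝ) ≤
      2 * ∑ i with groupOf P (X i) = g, weight P (groupOf P (X i)) (X i) + 1 := fun g => by
    have h := length_le_of_pairwise_one_lt (hinv g).one_lt fun B _ =>
      Finset.sum_nonneg fun i _ => hP.weight_nonneg g (hs i).le
    rw [(hinv g).sum_eq] at h
    refine h.trans_eq ?_
    congr 2
    exact Finset.sum_congr rfl fun i hi => by rw [(Finset.mem_filter.1 hi).2]
  have hmaps : ∀ i ∈ (Finset.univ : Finset (Fin n)), groupOf P (X i) ∈ (groupList P).toFinset :=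
    fun i _ => List.mem_toFinset.2 (groupOf_mem_groupList hP (hs i) (hs' i))
  have hcard : ((groupList P).toFinset.card : ℝ) = P.kMax - P.kMin + 3 := by
    rw [List.toFinset_card_of_nodup nodup_groupList, length_groupList hP]
  calc ((rpapc P ε X).length : ℝ)
      = ∑ g ∈ (groupList P).toFinset, ((rpapcState P ε X g).length : ℝ) := by
        rw [rpapc_eq_flatMap, List.length_flatMap, ← List.sum_toFinset _ nodup_groupList]
        push_cast
        rfl
    _ ≤ ∑ g ∈ (groupList P).toFinset,
          (2 * ∑ i with groupOf P (X i) = g, weight P (groupOf P (X i)) (X i) + 1) :=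
        Finset.sum_le_sum fun g _ => hlen g
    _ = 2 * ∑ i, weight P (groupOf P (X i)) (X i) + (P.kMax - P.kMin + 3) := by
        rw [Finset.sum_add_distrib, ← Finset.mul_sum, Finset.sum_fiberwise_of_maps_to hmaps,
          Finset.sum_const, nsmul_eq_mul, mul_one, hcard]

/-- The total mean size of the items is bounded by the number of bins of any viable packing. -/
lemma sum_mean_le_of_isViablePacking (hP : P.Valid) (hs : ∀ i, 0 ≤ (X i).size)
    (hs' : ∀ i, (X i).size ≤ 1) {bins : List (Finset (Fin n))}
    (h : IsViablePacking P.α X bins) :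
    ∑ i, (X i).prob * (X i).size ≤ bins.length * ((1 + P.α) / (1 - P.α)) := by
  have hnn : ∀ i, 0 ≤ ((X i).prob : ℝ) * (X i).size := fun i =>
    mul_nonneg (X i).prob.2.1 (hs i)
  have hα : 0 ≤ (1 + P.α) / (1 - P.α) :=
    div_nonneg (by linarith [hP.α_pos]) (by linarith [hP.α_le])
  calc ∑ i, ((X i).prob : ℝ) * (X i).size
      -- Only covering matters here; merging equal bins can only lower the count.
      ≤ ∑ i, ∑ B ∈ bins.toFinset, if i ∈ B then ((X i).prob : ℝ) * (X i).size else 0 := by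
        refine Finset.sum_le_sum fun i _ => ?_
        obtain ⟨B, hB, hi⟩ := h.covers i
        refine (if_pos hi).ge.trans (Finset.single_le_sum (f := fun B : Finset (Fin n) =>
          if i ∈ B then ((X i).prob : ℝ) * (X i).size else 0) (fun B _ => ?_)
          (List.mem_toFinset.2 hB))
        exact ite_nonneg (hnn i) le_rfl
    _ = ∑ B ∈ bins.toFinset, ∑ i ∈ B, ((X i).prob : ℝ) * (X i).size := by
        rw [Finset.sum_comm]
        simp
    _ ≤ ∑ B ∈ bins.toFinset, (1 + P.α) / (1 - P.α) :=
        Finset.sum_le_sum fun B hB => sum_mean_le_of_overflowProb_le hP hs hs'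
          (h.viable B (List.mem_toFinset.1 hB))
    _ ≤ bins.length * ((1 + P.α) / (1 - P.α)) := by
        rw [Finset.sum_const, nsmul_eq_mul]
        gcongr
        exact List.toFinset_card_le bins

end RPAPC

end StochasticBinPacking

theorem mainTheorem8 (P : StochasticBinPacking.Params)
    (hα : 0 < P.α) (hα' : P.α ≤ 1 / 2)
    (hsMax : P.sMax ≤ 1)
    (hsMin : 0 < P.sMin) (hsMin' : P.sMin < P.sMax)
    (hpMax : 0 < P.pMax) (hpMax' : P.pMax < 1)
    (ε : ℝ) (hε : 0 < ε)
    (n : ℕ) (X : Fin n → StochasticBinPacking.Item)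
    (hp : ∀ i, 0 < (X i).prob)
    (hs : ∀ i, 0 < (X i).size) (hs' : ∀ i, (X i).size ≤ P.sMax) :
    StochasticBinPacking.IsViablePacking P.α X (StochasticBinPacking.rpapc P ε X) ∧
      ((StochasticBinPacking.rpapc P ε X).length : ℝ) ≤
        P.approxConstant * (StochasticBinPacking.opt P.α X : ℝ) +
          ((P.kMax : ℝ) - (P.kMin : ℝ) + 3) := by
  have hP : P.Valid := ⟨hα, hα', hsMax, hsMin, hsMin', hpMax, hpMax'⟩
  have hviable := StochasticBinPacking.isViablePacking_rpapc hP hε hs hs'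
  refine ⟨hviable, (StochasticBinPacking.length_rpapc_le hP hε hs hs').trans ?_⟩
  -- The RPAPC packing makes the set nonempty, so the infimum `opt` is attained and is not the
  -- default 0.
  obtain ⟨bins, hbins, hlen⟩ := Nat.sInf_mem (s := {m | ∃ bins : List (Finset (Fin n)),
    StochasticBinPacking.IsViablePacking P.α X bins ∧ bins.length = m}) ⟨_, _, hviable, rfl⟩
  have hopt : bins.length = StochasticBinPacking.opt P.α X := hlen
  have hmean := StochasticBinPacking.sum_mean_le_of_isViablePacking hP (fun i => (hs i).le)
    (fun i => (hs' i).trans hsMax) hbins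
  have hμ := hP.muMin_pos
  have hα1 : 0 < 1 - P.α := by linarith
  refine add_le_add_left ?_ _
  calc 2 * ∑ i, StochasticBinPacking.weight P (StochasticBinPacking.groupOf P (X i)) (X i)
      ≤ 2 * ∑ i, ((X i).prob * (X i).size / (2 * P.muMin) : ℝ) := by
        gcongr with i
        exact hP.weight_le (hs i) (hs' i)
    _ = (∑ i, ((X i).prob * (X i).size : ℝ)) / P.muMin := by
        rw [← Finset.sum_div]
        field_simp
    _ ≤ bins.length * ((1 + P.α) / (1 - P.α)) / P.muMin := by gcongr
    _ = P.approxConstant * (StochasticBinPacking.opt P.α X : ℝ) := by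
        rw [hopt, StochasticBinPacking.Params.approxConstant]
        field_simp
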